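/- Let $\Bbbk$ be an algebraically closed field of characteristic zero, $A$ a Hopf algebra over $\Bbbk$ and $R$ a unital associative $\Bbbk$-algebra. Sweedler notation $\Delta(h)=h_1\otimes h_2$ is used throughout. For a Hopf algebra $\mathcal H$, consider the following conditions on a linear map $\cdot:\mathcal H\otimes R\to R$, for all $h,l\in\mathcal H$ and $r,s\in R$: - (PA.1) $1_{\mathcal H}\cdot r=r$; - (PA.2) $h\cdot(rs)=(h_1\cdot r)(h_2\cdot s)$; - (PA.3) $h\cdot(l\cdot r)=(h_1\cdot 1_R)(h_2l\cdot r)$; - (PA.S) $h\cdot(l\cdot r)=(h_1l\cdot r)(h_2\cdot 1_R)$. The map is a *partial action* of $\mathcal H$ on $R$ if it satisfies (PA.1)–(PA.3), and a *symmetric* partial action if it also satisfies (PA.S). Let $\sigma$ be an algebra automorphism of $A$ and let $A[x,\sigma]$ be the Ore extension, that is, the algebra of skew polynomials $\sum_i a_ix^i$ with $a_i\in A$ and $xa=\sigma(a)x$. Suppose that $A[x,\sigma]$ is a Hopf–Ore extension of $A$: it carries a Hopf algebra structure that extends the one of $A$ and satisfies $\Delta(x)=x\otimes 1+g\otimes x$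 for a grouplike element $g\in A$. Let $\chi=\varepsilon\circ\sigma:A\to\Bbbk$, where $\varepsilon$ is the counit of $A$; this is the character with $\sigma(a)=\chi(a_1)a_2=g\,a_1g^{-1}\chi(a_2)$ for all $a\in A$. Put $q=\chi(g)$. For $p\in\Bbbk^\times$, let $\binom{n}{m}_p$ be the $p$-binomial coefficients, defined by $\binom00_p=1$, $\binom nm_p=0$ for $m>n$ or $m<0$, and $\binom nm_p=\binom{n-1}m_p+p^{\,n-m}\binom{n-1}{m-1}_p$ for $n\ge 1$, $0\le m\le n$. Let $\cdot:A\otimes R\to R$ be a partial action of $A$ on $R$ with $g\cdot 1_R=0$, and fix an element $w\in R$. Then there is a unique linear map $\cdot:A[x,\sigma]\otimes R\to R$ with $$x^ja\cdot r=\sum_{k=0}^{j}(-1)^k q^{-\frac{k(k-1)}2}\binom jk_{q^{-1}}w^{j-k}(g^ka\cdot r)w^k\qquad(a\in A,\ r\in R,\ j\ge 0).$$ It extends the given partial action of $A$, and the following hold. (i) It satisfies (PA.1). (ii) It satisfies (PA.2). (iii) If $$a\cdot(x^jb\cdot r)=(a_1\cdot 1_R)(a_2x^jb\cdot r)\qquad\text{for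 all }a,b\in A,\ r\in R,\ j\ge0, \tag{1}$$ then it satisfies (PA.3). (iv) If $$a\cdot(x^jb\cdot r)=(a_1x^jb\cdot r)(a_2\cdot 1_R)\qquad\text{for all }a,b\in A,\ r\in R,\ j\ge0, \tag{2}$$ then it satisfies (PA.S). Consequently, if (1) holds, then the map is a partial action of $A[x,\sigma]$ on $R$ extending the given one, and it is symmetric if (2) holds as well. -/

import Mathlib

open scoped TensorProduct

noncomputable section

/-- The q-binomial coefficient `(n choose m)_q`, by the recursion
`(n choose m)_q = (n-1 choose m)_q + q^(n-m) (n-1 choose m-1)_q`, with `(0 choose 0)_q = 1` and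
`(n choose m)_q = 0` for `m > n`. -/
def qBinom {k : Type*} [Field k] (q : k) : ℕ → ℕ → k
  | _, 0 => 1
  | 0, _ + 1 => 0
  | n + 1, m + 1 => qBinom q n (m + 1) + q ^ (n - m) * qBinom q n m

/-- `h ↦ f(h_1) f'(h_2)` in Sweedler notation, with the product taken in the algebra `R`. -/
def sweedlerMul {k H R : Type*} [Field k] [Ring H] [Bialgebra k H] [Ring R] [Algebra k R]
    (f f' : H →ₗ[k] R) : H →ₗ[k] R :=
  LinearMap.mul' k R ∘ₗ TensorProduct.map f f' ∘ₗ Coalgebra.comul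

/-! ### Partial actions

A linear map `H ⊗ R → R`, `h ⊗ r ↦ h · r`, is written as `act : H →ₗ[k] R →ₗ[k] R`. -/

section PartialAction

variable {k H R : Type*} [Field k] [Ring H] [Bialgebra k H] [Ring R] [Algebra k R]

/-- `1_H · r = r`. -/
def PA1 (act : H →ₗ[k] R →ₗ[k] R) : Prop :=
  ∀ r : R, act 1 r = r

/-- `h · (r s) = (h_1 · r)(h_2 · s)`. -/
def PA2 (act : H →ₗ[k] R →ₗ[k] R) : Prop :=
  ∀ (h : H) (r s : R), act h (r * s) = sweedlerMul (act.flip r) (act.flip s) h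

/-- `h · (l · r) = (h_1 · 1_R)(h_2 l · r)`. -/
def PA3 (act : H →ₗ[k] R →ₗ[k] R) : Prop :=
  ∀ (h l : H) (r : R), act h (act l r) =
    sweedlerMul (act.flip 1) (act.flip r ∘ₗ LinearMap.mulRight k l) h

/-- `h · (l · r) = (h_1 l · r)(h_2 · 1_R)`. -/
def PAS (act : H →ₗ[k] R →ₗ[k] R) : Prop :=
  ∀ (h l : H) (r : R), act h (act l r) =
    sweedlerMul (act.flip r ∘ₗ LinearMap.mulRight k l) (act.flip 1) h

/-- A (left) partial action of `H` on `R`. -/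
structure IsPartialAction (act : H →ₗ[k] R →ₗ[k] R) : Prop where
  pa1 : PA1 act
  pa2 : PA2 act
  pa3 : PA3 act

/-- A symmetric (left) partial action of `H` on `R`. -/
structure IsSymmetricPartialAction (act : H →ₗ[k] R →ₗ[k] R) : Prop extends
    IsPartialAction act where
  paS : PAS act

end PartialAction

/-! ### Ore extensions `A[x, σ]` -/

section Ore

variable {k A : Type*} [Field k] [Ring A] [Algebra k A]

/-- The action of the monoid `(ℕ, +)` on `A` in which `n` acts by `σ ^ n`. -/
@[reducible] def oreAction (σ : A ≃ₐ[k] A) : MulSemiringAction (Multiplicative ℕ) A :=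
  MulSemiringAction.compHom A (powersHom (A ≃ₐ[k] A) σ)

/-- The Ore extension `A[x, σ]` (zero derivation): the skew polynomials `∑ a_i x^i` with
coefficients in `A`, multiplied by the rule `x a = σ(a) x`. -/
def OreExtension (_σ : A ≃ₐ[k] A) : Type _ := SkewPolynomial A

instance OreExtension.instRing (σ : A ≃ₐ[k] A) : Ring (OreExtension σ) :=
  letI := oreAction σ
  inferInstanceAs (Ring (SkewPolynomial A))

namespace OreExtension

/-- The variable `x` of `A[x, σ]`. -/
def X (σ : A ≃ₐ[k] A) : OreExtension σ := (SkewPolynomial.X : SkewPolynomial A)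

/-- The inclusion of `A` in `A[x, σ]` as the constant polynomials. -/
def C (σ : A ≃ₐ[k] A) : A →+* OreExtension σ :=
  letI := oreAction σ
  (SkewPolynomial.CRingHom : A →+* SkewPolynomial A)

/-- The coefficient of `x^n` in `∑ a_i x^i`. -/
def coeff (σ : A ≃ₐ[k] A) (n : ℕ) (p : OreExtension σ) : A :=
  SkewPolynomial.coeff (p : SkewPolynomial A) n

theorem X_mul_C (σ : A ≃ₐ[k] A) (a : A) : X σ * C σ a = C σ (σ a) * X σ := by
  let _ := oreAction σ
  have h : (SkewPolynomial.X * SkewPolynomial.monomial 0 a : SkewPolynomial A) =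
      SkewPolynomial.C (σ a) * SkewPolynomial.X := by
    rw [SkewPolynomial.X_mul_monomial, SkewPolynomial.C_mul_X_eq_monomial]
    congr 1
  exact h

theorem coeff_add (σ : A ≃ₐ[k] A) (n : ℕ) (p p' : OreExtension σ) :
    coeff σ n (p + p') = coeff σ n p + coeff σ n p' :=
  DFunLike.congr_fun (SkewMonoidAlgebra.coeff_add (k := A) (G := Multiplicative ℕ) p p')
    (Multiplicative.ofAdd n)

theorem coeff_C (σ : A ≃ₐ[k] A) (n : ℕ) (a : A) :
    coeff σ n (C σ a) = if n = 0 then a else 0 :=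
  SkewPolynomial.coeff_C

theorem coeff_C_mul (σ : A ≃ₐ[k] A) (n : ℕ) (a : A) (p : OreExtension σ) :
    coeff σ n (C σ a * p) = a * coeff σ n p := by
  let _ := oreAction σ
  exact SkewMonoidAlgebra.coeff_single_one_mul p a _

theorem coeff_X (σ : A ≃ₐ[k] A) (n : ℕ) : coeff σ n (X σ) = if 1 = n then 1 else 0 :=
  SkewPolynomial.coeff_X

end OreExtension

end Ore

/-! ### Hopf-Ore extensions -/

section HopfOre

open Coalgebra TensorProduct

variable {k A : Type*} [Field k] [Ring A] [HopfAlgebra k A]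

/-- The given Hopf algebra structure on the ring `A[x, σ]` makes it a Hopf-Ore extension of `A`
with respect to the grouplike `g`: the inclusion of `A` is a map of bialgebras (so that the Hopf
structure, and in particular the `k`-algebra structure, extends the one of `A`), and
`Δ(x) = x ⊗ 1 + g ⊗ x`. -/
structure HopfOreExtension (σ : A ≃ₐ[k] A) (g : A) [HopfAlgebra k (OreExtension σ)] where
  /-- The inclusion of `A` in `A[x, σ]`, as a map of bialgebras. -/
  incl : A →ₐc[k] OreExtension σ
  incl_apply : ∀ a : A, incl a = OreExtension.C σ a
  isGroupLikeElem : IsGroupLikeElem k g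
  comul_X : comul (R := k) (OreExtension.X σ) =
    OreExtension.X σ ⊗ₜ[k] 1 + OreExtension.C σ g ⊗ₜ[k] OreExtension.X σ

/-- The character `χ = ε ∘ σ` of `A`. For a Hopf-Ore extension it satisfies
`σ(a) = χ(a_1) a_2 = g a_1 g⁻¹ χ(a_2)`, see `HopfOreExtension.eq_character_left` and
`HopfOreExtension.eq_character_right`. -/
def oreCharacter (σ : A ≃ₐ[k] A) : A →ₐ[k] k :=
  (Bialgebra.counitAlgHom k A).comp (σ : A →ₐ[k] A)

namespace HopfOreExtension

variable {σ : A ≃ₐ[k] A} {g : A} [HopfAlgebra k (OreExtension σ)]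

theorem smul_eq (E : HopfOreExtension σ g) (c : k) (p : OreExtension σ) :
    c • p = OreExtension.C σ (algebraMap k A c) * p := by
  rw [Algebra.smul_def, ← E.incl_apply]
  congr 1
  exact (AlgHomClass.commutes E.incl c).symm

/-- The `n`-th coefficient as a `k`-linear map. -/
def coeffₗ (E : HopfOreExtension σ g) (n : ℕ) : OreExtension σ →ₗ[k] A where
  toFun := OreExtension.coeff σ n
  map_add' := OreExtension.coeff_add σ n
  map_smul' c p := by
    rw [E.smul_eq, OreExtension.coeff_C_mul, RingHom.id_apply, Algebra.smul_def]

theorem coeffₗ_apply (E : HopfOreExtension σ g) (n : ℕ) (p : OreExtension σ) :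
    E.coeffₗ n p = OreExtension.coeff σ n p := rfl

theorem comul_C (E : HopfOreExtension σ g) (a : A) :
    comul (R := k) (OreExtension.C σ a) =
      TensorProduct.map (E.incl : A →ₗ[k] OreExtension σ) (E.incl : A →ₗ[k] OreExtension σ)
        (comul a) := by
  rw [← E.incl_apply]
  exact (CoalgHomClass.map_comp_comul_apply E.incl a).symm

theorem comul_X_mul_C (E : HopfOreExtension σ g) (a : A) :
    comul (R := k) (OreExtension.X σ) * comul (R := k) (OreExtension.C σ a) =
      comul (R := k) (OreExtension.C σ (σ a)) * comul (R := k) (OreExtension.X σ) := by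
  rw [← Bialgebra.comul_mul, ← Bialgebra.comul_mul, OreExtension.X_mul_C]

theorem map_coeff_left (E : HopfOreExtension σ g) (m n : ℕ) (t : A ⊗[k] A) :
    TensorProduct.map (E.coeffₗ m) (E.coeffₗ n)
      (comul (R := k) (OreExtension.X σ) *
        TensorProduct.map (E.incl : A →ₗ[k] OreExtension σ) (E.incl : A →ₗ[k] OreExtension σ) t) =
      (if 1 = m ∧ n = 0 then TensorProduct.map σ.toLinearMap LinearMap.id t else 0) +
      (if m = 0 ∧ 1 = n then TensorProduct.map (LinearMap.mulLeft k g) σ.toLinearMap t else 0) := by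
  induction t with
  | zero => simp
  | add t u ht hu =>
    rw [map_add, mul_add, map_add, ht, hu]
    split_ifs <;> simp [add_add_add_comm]
  | tmul b c =>
    rw [E.comul_X, TensorProduct.map_tmul, add_mul, map_add, Algebra.TensorProduct.tmul_mul_tmul,
      Algebra.TensorProduct.tmul_mul_tmul, TensorProduct.map_tmul, TensorProduct.map_tmul]
    have h (a : A) : (E.incl : A →ₗ[k] OreExtension σ) a = OreExtension.C σ a := E.incl_apply a
    simp only [h, one_mul, OreExtension.X_mul_C, coeffₗ_apply, OreExtension.coeff_C_mul,
      OreExtension.coeff_X, OreExtension.coeff_C, ← map_mul]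
    congr 1 <;> split_ifs <;> simp_all

theorem map_coeff_right (E : HopfOreExtension σ g) (m n : ℕ) (t : A ⊗[k] A) :
    TensorProduct.map (E.coeffₗ m) (E.coeffₗ n)
      (TensorProduct.map (E.incl : A →ₗ[k] OreExtension σ) (E.incl : A →ₗ[k] OreExtension σ) t *
        comul (R := k) (OreExtension.X σ)) =
      (if 1 = m ∧ n = 0 then t else 0) +
      (if m = 0 ∧ 1 = n then
        TensorProduct.map (LinearMap.mulRight k g) LinearMap.id t else 0) := by
  induction t with
  | zero => simp
  | add t u ht hu =>
    rw [map_add, add_mul, map_add, ht, hu]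
    split_ifs <;> simp [add_add_add_comm]
  | tmul b c =>
    rw [E.comul_X, TensorProduct.map_tmul, mul_add, map_add, Algebra.TensorProduct.tmul_mul_tmul,
      Algebra.TensorProduct.tmul_mul_tmul, TensorProduct.map_tmul, TensorProduct.map_tmul]
    have h (a : A) : (E.incl : A →ₗ[k] OreExtension σ) a = OreExtension.C σ a := E.incl_apply a
    simp only [h, mul_one, coeffₗ_apply, OreExtension.coeff_C_mul,
      OreExtension.coeff_X, OreExtension.coeff_C, ← map_mul]
    congr 1 <;> split_ifs <;> simp_all

/-- `σ(a) = χ(a_1) a_2`. -/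
theorem eq_character_left (E : HopfOreExtension σ g) (a : A) :
    σ a = TensorProduct.lid k A
      (TensorProduct.map (oreCharacter σ).toLinearMap LinearMap.id (comul a)) := by
  have h := congrArg (TensorProduct.map (E.coeffₗ 1) (E.coeffₗ 0)) (E.comul_X_mul_C a)
  rw [E.comul_C, E.comul_C, E.map_coeff_left, E.map_coeff_right] at h
  simp only [and_self, if_true, one_ne_zero, if_false, add_zero] at h
  have h2 := congrArg (TensorProduct.lid k A ∘ (counit (R := k) (A := A)).rTensor A) h
  simp only [Function.comp_apply, rTensor_counit_comul, TensorProduct.lid_tmul, one_smul] at h2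
  rw [← h2, LinearMap.rTensor, ← LinearMap.comp_apply, ← TensorProduct.map_comp]
  rfl

/-- `σ(a) = g a_1 g⁻¹ χ(a_2)`, where `g⁻¹ = S(g)`. -/
theorem eq_character_right (E : HopfOreExtension σ g) (a : A) :
    σ a = g * TensorProduct.rid k A
      (TensorProduct.map LinearMap.id (oreCharacter σ).toLinearMap (comul a)) *
        HopfAlgebra.antipode k g := by
  have h := congrArg (TensorProduct.map (E.coeffₗ 0) (E.coeffₗ 1)) (E.comul_X_mul_C a)
  rw [E.comul_C, E.comul_C, E.map_coeff_left, E.map_coeff_right] at h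
  simp only [and_self, if_true, one_ne_zero, if_false, zero_add] at h
  have hl (t : A ⊗[k] A) : TensorProduct.rid k A ((counit (R := k) (A := A)).lTensor A
      (TensorProduct.map (LinearMap.mulLeft k g) σ.toLinearMap t)) =
      g * TensorProduct.rid k A (TensorProduct.map LinearMap.id (oreCharacter σ).toLinearMap t) := by
    induction t with
    | zero => simp
    | add t u ht hu => simp only [map_add, ht, hu, mul_add]
    | tmul b c => simp [oreCharacter]
  have hr (t : A ⊗[k] A) : TensorProduct.rid k A ((counit (R := k) (A := A)).lTensor A
      (TensorProduct.map (LinearMap.mulRight k g) LinearMap.id t)) =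
      TensorProduct.rid k A ((counit (R := k) (A := A)).lTensor A t) * g := by
    induction t with
    | zero => simp
    | add t u ht hu => simp only [map_add, ht, hu, add_mul]
    | tmul b c => simp
  have h2 := congrArg (TensorProduct.rid k A ∘ (counit (R := k) (A := A)).lTensor A) h
  simp only [Function.comp_apply, hl, hr, lTensor_counit_comul, TensorProduct.rid_tmul,
    one_smul] at h2
  rw [h2, mul_assoc, E.isGroupLikeElem.mul_antipode_cancel, mul_one]

end HopfOreExtension

end HopfOre

/-! ### The compatibility conditions -/

section Compatibility

variable {k A R : Type*} [Field k] [Ring A] [HopfAlgebra k A] [Ring R] [Algebra k R]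
  {σ : A ≃ₐ[k] A} {g : A} [HopfAlgebra k (OreExtension σ)]

/-- `∑_{i=0}^j (-1)^i q^(-i(i-1)/2) (j choose i)_{q⁻¹} w^(j-i) (g^i a · r) w^i`. -/
def extensionFormula (act : A →ₗ[k] R →ₗ[k] R) (g : A) (q : k) (w : R) (j : ℕ) (a : A) (r : R) :
    R :=
  ∑ i ∈ Finset.range (j + 1),
    ((-1) ^ i * q⁻¹ ^ (i * (i - 1) / 2) * qBinom q⁻¹ j i) •
      (w ^ (j - i) * act (g ^ i * a) r * w ^ i)

/-- `a · (x^j b · r) = (a_1 · 1_R)(a_2 x^j b · r)` for all `a, b ∈ A`, `j ≥ 0`, `r ∈ R`, where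
`T` is the linear map `A[x, σ] ⊗ R → R`. -/
def LeftCompatible (E : HopfOreExtension σ g) (act : A →ₗ[k] R →ₗ[k] R)
    (T : OreExtension σ →ₗ[k] R →ₗ[k] R) : Prop :=
  ∀ (j : ℕ) (a b : A) (r : R),
    act a (T (OreExtension.X σ ^ j * OreExtension.C σ b) r) =
      sweedlerMul (act.flip 1)
        (T.flip r ∘ₗ LinearMap.mulRight k (OreExtension.X σ ^ j * OreExtension.C σ b) ∘ₗ
          (E.incl : A →ₗ[k] OreExtension σ)) a

/-- `a · (x^j b · r) = (a_1 x^j b · r)(a_2 · 1_R)` for all `a, b ∈ A`, `j ≥ 0`, `r ∈ R`, where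
`T` is the linear map `A[x, σ] ⊗ R → R`. -/
def RightCompatible (E : HopfOreExtension σ g) (act : A →ₗ[k] R →ₗ[k] R)
    (T : OreExtension σ →ₗ[k] R →ₗ[k] R) : Prop :=
  ∀ (j : ℕ) (a b : A) (r : R),
    act a (T (OreExtension.X σ ^ j * OreExtension.C σ b) r) =
      sweedlerMul
        (T.flip r ∘ₗ LinearMap.mulRight k (OreExtension.X σ ^ j * OreExtension.C σ b) ∘ₗ
          (E.incl : A →ₗ[k] OreExtension σ))
        (act.flip 1) a

end Compatibility

end

/-! The map `T` is governed by a recursion. With `q = χ(g)` one has `g x = q⁻¹ x g`, and the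
recursion of the `q`-binomial coefficients turns the explicit formula into
`T(x h) r = w T(h) r - T(g h) r w` for all `h ∈ A[x, σ]` (`IsSkewRecursive.of_extensionFormula`).

Call a linear map `f : A[x, σ] → R` skew recursive if `f(x h) = w f(h) - f(g h) w`. Two facts carry
the proof.

* A skew recursive map is determined by its restriction to `A` (`IsSkewRecursive.eq_of_eq_on_C`).
* If `f` and `f'` are skew recursive, so is `h ↦ f(h_1) f'(h_2)` (`IsSkewRecursive.sweedlerMul`):
  by `Δ(x) = x ⊗ 1 + g ⊗ x`, its value at `x h` is
  `(w f(h_1) - f(g h_1) w) f'(h_2) + f(g h_1) (w f'(h_2) - f'(g h_2) w)`, where the middle terms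
  cancel.

In each of (PA.2), (PA.3) and (PA.S) both sides are skew recursive in the first argument, so it
suffices to compare them on `A`. There the identity is the one for the given partial action in the
first case, and the compatibility condition in the other two. Existence and uniqueness of `T` hold
because `A[x, σ]` is the direct sum over `j` of the subspaces `x^j A`, with `a ↦ x^j a` injective
(`HopfOreExtension.lift`). -/

noncomputable section

/-! ### The elements `x^j a` of an Ore extension -/

namespace OreExtension

variable {k A : Type*} [Field k] [Ring A] [Algebra k A]

theorem X_pow_mul_C (σ : A ≃ₐ[k] A) (j : ℕ) (a : A) :
    X σ ^ j * C σ a = C σ ((σ ^ j) a) * X σ ^ j := by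
  induction j generalizing a with
  | zero => simp
  | succ j ih =>
    rw [pow_succ (X σ), mul_assoc, X_mul_C, ← mul_assoc, ih, mul_assoc, pow_succ σ,
      AlgEquiv.mul_apply]

/-- The coefficients of a skew polynomial as a finitely supported function. -/
def coeffFinsupp (σ : A ≃ₐ[k] A) (p : OreExtension σ) : Multiplicative ℕ →₀ A :=
  SkewMonoidAlgebra.coeff (p : SkewPolynomial A)

theorem coeffFinsupp_X_pow_mul_C (σ : A ≃ₐ[k] A) (j : ℕ) (a : A) :
    coeffFinsupp σ (X σ ^ j * C σ a) = Finsupp.single (Multiplicative.ofAdd j) ((σ ^ j) a) := by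
  rw [X_pow_mul_C]
  let _ := oreAction σ
  exact congrArg SkewMonoidAlgebra.coeff
    (SkewPolynomial.C_mul_X_pow_eq_monomial (R := A) (n := j) (a := (σ ^ j) a))

theorem induction_X_pow_mul_C {σ : A ≃ₐ[k] A} {P : OreExtension σ → Prop} (p : OreExtension σ)
    (zero : P 0) (add : ∀ p p', P p → P p' → P (p + p'))
    (X_pow_mul_C : ∀ j a, P (X σ ^ j * C σ a)) : P p := by
  refine SkewMonoidAlgebra.induction_on (p := P) p zero (fun n a => ?_) add
  have h := X_pow_mul_C n.toAdd ((σ ^ n.toAdd).symm a)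
  rw [OreExtension.X_pow_mul_C, AlgEquiv.apply_symm_apply] at h
  let _ := oreAction σ
  have e : C σ a * X σ ^ n.toAdd = (SkewMonoidAlgebra.single n a : SkewPolynomial A) :=
    SkewPolynomial.C_mul_X_pow_eq_monomial (R := A) (n := n.toAdd) (a := a)
  rwa [e] at h

end OreExtension

namespace HopfOreExtension

variable {k A : Type*} [Field k] [Ring A] [HopfAlgebra k A] {σ : A ≃ₐ[k] A} {g : A}
  [HopfAlgebra k (OreExtension σ)]

/-- `OreExtension.coeffFinsupp` as a `k`-linear map. -/
def coeffFinsuppₗ (E : HopfOreExtension σ g) : OreExtension σ →ₗ[k] Multiplicative ℕ →₀ A where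
  toFun := OreExtension.coeffFinsupp σ
  map_add' p p' := SkewMonoidAlgebra.coeff_add (k := A) (G := Multiplicative ℕ) p p'
  map_smul' c p := Finsupp.ext fun n => (E.coeffₗ n.toAdd).map_smul c p

/-- The linear map with prescribed linear restrictions `a ↦ F j a` to the summands
`{x^j a | a ∈ A}`. -/
def lift {M : Type*} [AddCommGroup M] [Module k M] (E : HopfOreExtension σ g)
    (F : ℕ → A →ₗ[k] M) : OreExtension σ →ₗ[k] M :=
  Finsupp.lsum k (fun n : Multiplicative ℕ =>
    F n.toAdd ∘ₗ (σ ^ n.toAdd).symm.toLinearMap) ∘ₗ E.coeffFinsuppₗ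

theorem lift_X_pow_mul_C {M : Type*} [AddCommGroup M] [Module k M] (E : HopfOreExtension σ g)
    (F : ℕ → A →ₗ[k] M) (j : ℕ) (a : A) :
    E.lift F (OreExtension.X σ ^ j * OreExtension.C σ a) = F j a := by
  have h : E.coeffFinsuppₗ (OreExtension.X σ ^ j * OreExtension.C σ a) = _ :=
    OreExtension.coeffFinsupp_X_pow_mul_C σ j a
  rw [lift, LinearMap.comp_apply, h, Finsupp.lsum_single]
  exact congrArg (F j) ((σ ^ j).symm_apply_apply a)

theorem linearMap_ext {M : Type*} [AddCommGroup M] [Module k M] {f f' : OreExtension σ →ₗ[k] M}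
    (h : ∀ j a, f (OreExtension.X σ ^ j * OreExtension.C σ a) =
      f' (OreExtension.X σ ^ j * OreExtension.C σ a)) : f = f' := by
  ext p
  induction p using OreExtension.induction_X_pow_mul_C with
  | zero => simp
  | add p p' hp hp' => rw [map_add, map_add, hp, hp']
  | X_pow_mul_C j a => exact h j a

/-! ### Commuting `g` past `x` -/

theorem apply_groupLike (E : HopfOreExtension σ g) : σ g = oreCharacter σ g • g := by
  rw [E.eq_character_left, E.isGroupLikeElem.comul_eq_tmul_self]
  simp

theorem oreCharacter_ne_zero (E : HopfOreExtension σ g) : oreCharacter σ g ≠ 0 := by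
  have h := congrArg (oreCharacter σ) E.isGroupLikeElem.mul_antipode_cancel
  rw [map_mul, map_one] at h
  exact left_ne_zero_of_mul_eq_one h

theorem C_smul (E : HopfOreExtension σ g) (c : k) (a : A) :
    OreExtension.C σ (c • a) = c • OreExtension.C σ a := by
  rw [← E.incl_apply, ← E.incl_apply, map_smul]

theorem C_mul_X_pow (E : HopfOreExtension σ g) (j : ℕ) :
    OreExtension.C σ g * OreExtension.X σ ^ j =
      (oreCharacter σ g)⁻¹ ^ j • (OreExtension.X σ ^ j * OreExtension.C σ g) := by
  have h (n : ℕ) : (σ ^ n) g = oreCharacter σ g ^ n • g := by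
    induction n with
    | zero => simp
    | succ n ih =>
      rw [pow_succ', AlgEquiv.mul_apply, ih, map_smul, E.apply_groupLike, smul_smul, pow_succ]
  rw [OreExtension.X_pow_mul_C, h, E.C_smul, smul_mul_assoc, smul_smul, ← mul_pow,
    inv_mul_cancel₀ E.oreCharacter_ne_zero, one_pow, one_smul]

theorem C_mul_X_pow_mul_C (E : HopfOreExtension σ g) (j : ℕ) (a : A) :
    OreExtension.C σ g * (OreExtension.X σ ^ j * OreExtension.C σ a) =
      (oreCharacter σ g)⁻¹ ^ j • (OreExtension.X σ ^ j * OreExtension.C σ (g * a)) := by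
  rw [← mul_assoc, E.C_mul_X_pow, smul_mul_assoc, mul_assoc, map_mul]

end HopfOreExtension

/-! ### Skew recursive maps -/

/-- A linear map `f` satisfying `f(x h) = w f(h) - f(g h) w` for all `h`. -/
def IsSkewRecursive {k H R : Type*} [Field k] [Ring H] [Algebra k H] [Ring R] [Algebra k R]
    (x g : H) (w : R) (f : H →ₗ[k] R) : Prop :=
  ∀ h, f (x * h) = w * f h - f (g * h) * w

namespace IsSkewRecursive

section Bialgebra

variable {k H R : Type*} [Field k] [Ring H] [Bialgebra k H] [Ring R] [Algebra k R]
  {x g : H} {w : R} {f f' : H →ₗ[k] R}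

theorem comp_mulRight (hf : IsSkewRecursive x g w f) (l : H) :
    IsSkewRecursive x g w (f ∘ₗ LinearMap.mulRight k l) := fun h => by
  simpa [mul_assoc] using hf (h * l)

/-- The product `h ↦ f(h_1) f'(h_2)` of skew recursive maps is skew recursive. -/
protected theorem sweedlerMul (hf : IsSkewRecursive x g w f) (hf' : IsSkewRecursive x g w f')
    (hg : Coalgebra.comul (R := k) g = g ⊗ₜ[k] g)
    (hx : Coalgebra.comul (R := k) x = x ⊗ₜ[k] 1 + g ⊗ₜ[k] x) :
    IsSkewRecursive x g w (sweedlerMul f f') := fun h => by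
  simp only [sweedlerMul, LinearMap.comp_apply, Bialgebra.comul_mul, hg, hx]
  induction Coalgebra.comul (R := k) h with
  | zero => simp
  | add t u ht hu =>
    simp only [mul_add, map_add, add_mul] at ht hu ⊢
    rw [ht, hu, add_sub_add_comm]
  | tmul b c =>
    simp only [add_mul, Algebra.TensorProduct.tmul_mul_tmul, map_add, TensorProduct.map_tmul,
      LinearMap.mul'_apply, one_mul, hf b, hf' c]
    noncomm_ring

end Bialgebra

variable {k A R : Type*} [Field k] [Ring A] [HopfAlgebra k A] [Ring R] [Algebra k R]
  {σ : A ≃ₐ[k] A} {g : A} [HopfAlgebra k (OreExtension σ)] {w : R}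

/-- A skew recursive map on a Hopf-Ore extension is determined by its restriction to `A`. -/
theorem eq_of_eq_on_C {f f' : OreExtension σ →ₗ[k] R} (E : HopfOreExtension σ g)
    (hf : IsSkewRecursive (OreExtension.X σ) (OreExtension.C σ g) w f)
    (hf' : IsSkewRecursive (OreExtension.X σ) (OreExtension.C σ g) w f')
    (h : ∀ a, f (OreExtension.C σ a) = f' (OreExtension.C σ a)) : f = f' := by
  refine HopfOreExtension.linearMap_ext fun j => ?_
  induction j with
  | zero => simpa using h
  | succ j ih =>
    intro a
    rw [pow_succ', mul_assoc, hf, hf', E.C_mul_X_pow_mul_C, map_smul, map_smul, ih, ih]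

end IsSkewRecursive

/-! ### The explicit formula -/

section Formula

variable {k A R : Type*} [Field k] [Ring A] [HopfAlgebra k A] [Ring R] [Algebra k R]

theorem qBinom_zero_right (p : k) (n : ℕ) : qBinom p n 0 = 1 := by
  cases n <;> rfl

theorem qBinom_eq_zero_of_lt (p : k) {n m : ℕ} (h : n < m) : qBinom p n m = 0 := by
  induction n generalizing m with
  | zero => obtain ⟨m, rfl⟩ := Nat.exists_eq_succ_of_ne_zero h.ne'; rfl
  | succ n ih =>
    obtain ⟨m, rfl⟩ := Nat.exists_eq_succ_of_ne_zero (Nat.ne_zero_of_lt h)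
    simp [qBinom, ih (m := m + 1) (by omega), ih (m := m) (by omega)]

theorem extensionFormula_zero (act : A →ₗ[k] R →ₗ[k] R) (g : A) (q : k) (w : R) (a : A) (r : R) :
    extensionFormula act g q w 0 a r = act a r := by
  simp [extensionFormula, qBinom]

/-- Pascal's rule for the `q`-binomial coefficients, summed up. -/
theorem extensionFormula_succ (act : A →ₗ[k] R →ₗ[k] R) (g : A) (q : k) (w : R) (j : ℕ) (a : A)
    (r : R) : extensionFormula act g q w (j + 1) a r =
      w * extensionFormula act g q w j a r -
        q⁻¹ ^ j • (extensionFormula act g q w j (g * a) r * w) := by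
  have hc (i : ℕ) (hi : i ≤ j) :
      (-1) ^ (i + 1) * q⁻¹ ^ ((i + 1) * (i + 1 - 1) / 2) * qBinom q⁻¹ (j + 1) (i + 1) =
      (-1) ^ (i + 1) * q⁻¹ ^ ((i + 1) * (i + 1 - 1) / 2) * qBinom q⁻¹ j (i + 1) -
      q⁻¹ ^ j * ((-1) ^ i * q⁻¹ ^ (i * (i - 1) / 2) * qBinom q⁻¹ j i) := by
    have ht : (i + 1) * (i + 1 - 1) / 2 = i * (i - 1) / 2 + i := by
      have := Finset.sum_range_succ (fun n => n) i
      rwa [Finset.sum_range_id, Finset.sum_range_id] at this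
    have hj : q⁻¹ ^ j = q⁻¹ ^ i * q⁻¹ ^ (j - i) := by rw [← pow_add, Nat.add_sub_cancel' hi]
    rw [ht, hj, qBinom]
    ring
  -- The sum may run up to `j + 1`, since the coefficient `(j choose j + 1)` vanishes.
  have h1 : w * extensionFormula act g q w j a r = ∑ i ∈ Finset.range (j + 1 + 1),
      ((-1) ^ i * q⁻¹ ^ (i * (i - 1) / 2) * qBinom q⁻¹ j i) •
        (w ^ (j + 1 - i) * act (g ^ i * a) r * w ^ i) := by
    rw [Finset.sum_range_succ, qBinom_eq_zero_of_lt _ (Nat.lt_succ_self j), mul_zero, zero_smul,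
      add_zero, extensionFormula, Finset.mul_sum]
    refine Finset.sum_congr rfl fun i hi => ?_
    rw [Nat.sub_add_comm (Finset.mem_range_succ_iff.mp hi), pow_succ', mul_smul_comm]
    simp only [mul_assoc]
  rw [h1, extensionFormula, extensionFormula, Finset.sum_range_succ',
    Finset.sum_range_succ' _ (j + 1), Finset.sum_mul, Finset.smul_sum, qBinom_zero_right,
    qBinom_zero_right, add_sub_right_comm, ← Finset.sum_sub_distrib]
  congr 1
  refine Finset.sum_congr rfl fun i hi => ?_
  rw [hc i (Finset.mem_range_succ_iff.mp hi), sub_smul, smul_mul_assoc, smul_smul,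
    Nat.add_sub_add_right j 1 i, pow_succ g, pow_succ w]
  simp only [mul_assoc]

/-- The explicit formula as a bilinear map in `a` and `r`. -/
def extensionFormulaₗ (act : A →ₗ[k] R →ₗ[k] R) (g : A) (q : k) (w : R) (j : ℕ) :
    A →ₗ[k] R →ₗ[k] R :=
  LinearMap.mk₂ k (extensionFormula act g q w j)
    (fun a b r => by
      simp only [extensionFormula, mul_add, add_mul, map_add, LinearMap.add_apply, smul_add,
        Finset.sum_add_distrib])
    (fun c a r => by
      simp only [extensionFormula, mul_smul_comm, smul_mul_assoc, map_smul, LinearMap.smul_apply,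
        Finset.smul_sum, smul_comm c])
    (fun a r s => by
      simp only [extensionFormula, mul_add, add_mul, map_add, smul_add, Finset.sum_add_distrib])
    (fun c a r => by
      simp only [extensionFormula, mul_smul_comm, smul_mul_assoc, map_smul, Finset.smul_sum,
        smul_comm c])

variable {σ : A ≃ₐ[k] A} {g : A} [HopfAlgebra k (OreExtension σ)]

theorem IsSkewRecursive.of_extensionFormula (E : HopfOreExtension σ g) {act : A →ₗ[k] R →ₗ[k] R}
    {w : R} {T : OreExtension σ →ₗ[k] R →ₗ[k] R}
    (hT : ∀ (j : ℕ) (a : A) (r : R), T (OreExtension.X σ ^ j * OreExtension.C σ a) r =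
      extensionFormula act g (oreCharacter σ g) w j a r) (r : R) :
    IsSkewRecursive (OreExtension.X σ) (OreExtension.C σ g) w (T.flip r) := by
  intro h
  simp only [LinearMap.flip_apply]
  induction h using OreExtension.induction_X_pow_mul_C with
  | zero => simp
  | add p p' hp hp' =>
    simp only [mul_add, map_add, LinearMap.add_apply, add_mul, hp, hp']
    abel
  | X_pow_mul_C j a =>
    rw [← mul_assoc (OreExtension.X σ), ← pow_succ', E.C_mul_X_pow_mul_C, map_smul,
      LinearMap.smul_apply, hT, hT, hT, extensionFormula_succ, smul_mul_assoc]

end Formula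

/-! ### The product `h ↦ f(h_1) f'(h_2)` -/

section SweedlerMul

variable {k H R : Type*} [Field k] [Ring H] [Bialgebra k H] [Ring R] [Algebra k R]

theorem sweedlerMul_add_left (f₁ f₂ f' : H →ₗ[k] R) (h : H) :
    sweedlerMul (f₁ + f₂) f' h = sweedlerMul f₁ f' h + sweedlerMul f₂ f' h := by
  simp [sweedlerMul, TensorProduct.map_add_left]

theorem sweedlerMul_add_right (f f₁ f₂ : H →ₗ[k] R) (h : H) :
    sweedlerMul f (f₁ + f₂) h = sweedlerMul f f₁ h + sweedlerMul f f₂ h := by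
  simp [sweedlerMul, TensorProduct.map_add_right]

theorem comp_mulRight_add (f : H →ₗ[k] R) (l l' : H) :
    f ∘ₗ LinearMap.mulRight k (l + l') =
      f ∘ₗ LinearMap.mulRight k l + f ∘ₗ LinearMap.mulRight k l' := by
  ext h
  simp [mul_add]

end SweedlerMul

/-- `h ↦ f(h_1) f'(h_2)` restricts along the inclusion of `A`. -/
theorem HopfOreExtension.sweedlerMul_C {k A R : Type*} [Field k] [Ring A] [HopfAlgebra k A] [Ring R]
    [Algebra k R] {σ : A ≃ₐ[k] A} {g : A} [HopfAlgebra k (OreExtension σ)]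
    (E : HopfOreExtension σ g) (f f' : OreExtension σ →ₗ[k] R) (a : A) :
    sweedlerMul f f' (OreExtension.C σ a) =
      sweedlerMul (f ∘ₗ (E.incl : A →ₗ[k] OreExtension σ))
        (f' ∘ₗ (E.incl : A →ₗ[k] OreExtension σ)) a := by
  simp only [sweedlerMul, LinearMap.comp_apply, E.comul_C, TensorProduct.map_comp]

end

/-! ### The partial action axioms for the extension -/

theorem mainTheorem1 {k A R : Type*} [Field k] [IsAlgClosed k] [CharZero k]
    [Ring A] [HopfAlgebra k A] [Ring R] [Algebra k R]
    (σ : A ≃ₐ[k] A) (g : A) [HopfAlgebra k (OreExtension σ)] (E : HopfOreExtension σ g)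
    (act : A →ₗ[k] R →ₗ[k] R) (hact : IsPartialAction act) (hg : act g 1 = 0)
    (q : k) (hq : q = oreCharacter σ g) (w : R) :
    (∃! T : OreExtension σ →ₗ[k] R →ₗ[k] R, ∀ (j : ℕ) (a : A) (r : R),
      T (OreExtension.X σ ^ j * OreExtension.C σ a) r = extensionFormula act g q w j a r) ∧
    ∀ T : OreExtension σ →ₗ[k] R →ₗ[k] R,
      (∀ (j : ℕ) (a : A) (r : R),
        T (OreExtension.X σ ^ j * OreExtension.C σ a) r = extensionFormula act g q w j a r) →
      (∀ (a : A) (r : R), T (OreExtension.C σ a) r = act a r) ∧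
      PA1 T ∧
      PA2 T ∧
      (LeftCompatible E act T → PA3 T) ∧
      (RightCompatible E act T → PAS T) ∧
      (LeftCompatible E act T → IsPartialAction T) ∧
      (LeftCompatible E act T → RightCompatible E act T → IsSymmetricPartialAction T) := by
  subst hq
  refine ⟨⟨E.lift (extensionFormulaₗ act g (oreCharacter σ g) w), fun j a r => ?_, fun T hT => ?_⟩,
    fun T hT => ?_⟩
  · rw [E.lift_X_pow_mul_C]
    rfl
  · refine HopfOreExtension.linearMap_ext fun j a => LinearMap.ext fun r => ?_
    rw [E.lift_X_pow_mul_C]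
    exact hT j a r
  have hC (a : A) (r : R) : T (OreExtension.C σ a) r = act a r := by
    simpa [extensionFormula_zero] using hT 0 a r
  have hres (r : R) : T.flip r ∘ₗ (E.incl : A →ₗ[k] OreExtension σ) = act.flip r :=
    LinearMap.ext fun a => (congrArg (T · r) (E.incl_apply a)).trans (hC a r)
  have hrec := IsSkewRecursive.of_extensionFormula E hT
  have hgΔ : Coalgebra.comul (R := k) (OreExtension.C σ g) =
      OreExtension.C σ g ⊗ₜ[k] OreExtension.C σ g := by
    rw [E.comul_C, E.isGroupLikeElem.comul_eq_tmul_self, TensorProduct.map_tmul]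
    exact congrArg₂ (· ⊗ₜ[k] ·) (E.incl_apply g) (E.incl_apply g)
  have hmul {f f' : OreExtension σ →ₗ[k] R}
      (hf : IsSkewRecursive (OreExtension.X σ) (OreExtension.C σ g) w f)
      (hf' : IsSkewRecursive (OreExtension.X σ) (OreExtension.C σ g) w f') :=
    hf.sweedlerMul hf' hgΔ E.comul_X
  have h1 : PA1 T := fun r => by
    rw [← map_one (OreExtension.C σ), hC, hact.pa1]
  have h2 : PA2 T := fun h r s => by
    refine LinearMap.congr_fun (IsSkewRecursive.eq_of_eq_on_C (f := T.flip (r * s)) E (hrec _)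
      (hmul (hrec r) (hrec s)) fun a => ?_) h
    rw [E.sweedlerMul_C, hres, hres, LinearMap.flip_apply, hC, hact.pa2]
  -- Both sides of (PA.3) and (PA.S) are linear in `l`, so the compatibility conditions, stated for
  -- `l = x^j b`, give every `l`. The left side `h ↦ h · s` with `s = l · r` is skew recursive, like
  -- `h ↦ h · s` for any `s`.
  have h3 (hL : LeftCompatible E act T) : PA3 T := fun h l r => by
    induction l using OreExtension.induction_X_pow_mul_C with
    | zero => simp [sweedlerMul]
    | add l l' hl hl' =>
      rw [map_add, LinearMap.add_apply, map_add, hl, hl', comp_mulRight_add, sweedlerMul_add_right]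
    | X_pow_mul_C j b =>
      refine LinearMap.congr_fun (IsSkewRecursive.eq_of_eq_on_C (f := T.flip (T _ r)) E (hrec _)
        (hmul (hrec 1) ((hrec r).comp_mulRight _)) fun a => ?_) h
      rw [E.sweedlerMul_C, hres, LinearMap.flip_apply, hC, hL j a b r, LinearMap.comp_assoc]
  have hS (hR : RightCompatible E act T) : PAS T := fun h l r => by
    induction l using OreExtension.induction_X_pow_mul_C with
    | zero => simp [sweedlerMul]
    | add l l' hl hl' =>
      rw [map_add, LinearMap.add_apply, map_add, hl, hl', comp_mulRight_add, sweedlerMul_add_left]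
    | X_pow_mul_C j b =>
      refine LinearMap.congr_fun (IsSkewRecursive.eq_of_eq_on_C (f := T.flip (T _ r)) E (hrec _)
        (hmul ((hrec r).comp_mulRight _) (hrec 1)) fun a => ?_) h
      rw [E.sweedlerMul_C, hres, LinearMap.flip_apply, hC, hR j a b r, LinearMap.comp_assoc]
  exact ⟨hC, h1, h2, h3, hS, fun hL => ⟨h1, h2, h3 hL⟩, fun hL hR => ⟨⟨h1, h2, h3 hL⟩, hS hR⟩⟩
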